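/- Fix an algebraic type $\tau$ that contains at least one operation symbol of arity at least $2$ and possibly contains constant symbols. Algebras have nonempty universes, and a variety is a class of algebras of type $\tau$ closed under homomorphic images, subalgebras and (possibly empty) direct products. For a variety $\mathcal V$ let $\mathbf L(\mathcal V)$ be its lattice of subvarieties, ordered by inclusion. An identity is regular if the same variables occur on both of its sides; $R(\mathcal V)$ denotes the variety axiomatized by the regular identities that hold in $\mathcal V$. $\mathcal V$ is strongly irregular if there is a binary term $f(x,y)$, in which both $x$ and $y$ occur, with $\mathcal V\models f(x,y)\approx x$. Let $\mathcal{SL}=R(\mathcal T)$, where $\mathcal T$ is the trivial variety of type $\tau$, and let $\mathbf 2$ be the two-element semilattice $\{0<1\}$ viewed as an algebra of type $\tau$ (every operation symbol is interpreted as the join of its arguments, every constant as $0$). A pair $(a,b)$ of elements of a lattice $\mathbf L$ is a splitting pair if $a\nleq b$ and for every $c\in L$ either $a\le c$ or $c\le b$. An algebra $\mathbf A$ is splitting in $\mathbf L(\mathcal V)$ if $\mathbf A\in\mathcal V$ is subdirectly irreducible and finitely generated and, with $V(\mathbf A)$ the variety generated by $\mathbf A$, there is a $\mathcal V_2$ such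 that $(V(\mathbf A),\mathcal V_2)$ is a splitting pair in $\mathbf L(\mathcal V)$. Theorem. Let $\mathcal V$ be a strongly irregular variety of type $\tau$. (1) For all varieties $\mathcal V_1,\mathcal V_2$ of type $\tau$: $(\mathcal V_1,\mathcal V_2)$ is a splitting pair in $\mathbf L(R(\mathcal V))$ if and only if $(\mathcal V_1,\mathcal V_2)=(\mathcal{SL},\mathcal V)$, or there is $\mathcal W\in\mathbf L(\mathcal V)$ such that $\mathcal V_2=R(\mathcal W)$ and $(\mathcal V_1,\mathcal W)$ is a splitting pair in $\mathbf L(\mathcal V)$. (2) Consequently, an algebra $\mathbf A$ of type $\tau$ is splitting in $\mathbf L(R(\mathcal V))$ if and only if it is splitting in $\mathbf L(\mathcal V)$ or isomorphic to $\mathbf 2$. In particular, an algebra $\mathbf A\in\mathcal V$ is splitting in $\mathbf L(R(\mathcal V))$ if and only if it is splitting in $\mathbf L(\mathcal V)$. -/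

import Mathlib

universe u v

open scoped FirstOrder

namespace UniversalAlgebra

/-- An algebra of type `L`: a nonempty carrier with an interpretation of every operation symbol
of `L`. An algebraic type is a language `L` with `L.IsAlgebraic` (no relation symbols); operation
symbols of arity `0` (constants) are allowed. -/
structure Alg (L : FirstOrder.Language.{u, v}) where
  carrier : Type u
  [str : L.Structure carrier]
  [ne : Nonempty carrier]

instance (L : FirstOrder.Language.{u, v}) : CoeSort (Alg L) (Type u) := ⟨Alg.carrier⟩

instance (L : FirstOrder.Language.{u, v}) (A : Alg L) : L.Structure A := A.str

instance (L : FirstOrder.Language.{u, v}) (A : Alg L) : Nonempty A := A.ne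

/-- The subalgebra of `A` on a nonempty subuniverse. -/
def Alg.sub {L : FirstOrder.Language.{u, v}} (A : Alg L) (S : L.Substructure A) (hS : Nonempty S) : Alg L where
  carrier := S
  ne := hS

/-- The direct product of a (possibly empty) family of algebras, with coordinatewise operations. -/
def Alg.prod {L : FirstOrder.Language.{u, v}} {ι : Type u} (A : ι → Alg L) : Alg L where
  carrier := ∀ i, A i
  str :=
    { funMap := fun f x i => FirstOrder.Language.Structure.funMap f (fun k => x k i)
      RelMap := fun r x => ∀ i, FirstOrder.Language.Structure.RelMap r (fun k => x k i) }

/-- A variety: a class of algebras closed under homomorphic images, subalgebras and products. -/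
@[ext]
structure Variety (L : FirstOrder.Language.{u, v}) where
  carrier : Set (Alg L)
  hom_mem : ∀ (A B : Alg L) (f : A →[L] B), Function.Surjective f → A ∈ carrier → B ∈ carrier
  sub_mem : ∀ (A : Alg L) (S : L.Substructure A) (hS : Nonempty S),
    A ∈ carrier → A.sub S hS ∈ carrier
  prod_mem : ∀ (ι : Type u) (A : ι → Alg L), (∀ i, A i ∈ carrier) → Alg.prod A ∈ carrier

instance (L : FirstOrder.Language.{u, v}) : SetLike (Variety L) (Alg L) where
  coe := Variety.carrier
  coe_injective := fun _ _ h => Variety.ext h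

/-- Varieties are ordered by inclusion. -/
instance (L : FirstOrder.Language.{u, v}) : PartialOrder (Variety L) :=
  PartialOrder.lift (fun V => (V : Set (Alg L))) SetLike.coe_injective

/-- The intersection of a set of varieties. -/
instance (L : FirstOrder.Language.{u, v}) : InfSet (Variety L) where
  sInf S :=
    { carrier := {A | ∀ V ∈ S, A ∈ V}
      hom_mem := fun A B f hf hA V hV => V.hom_mem A B f hf (hA V hV)
      sub_mem := fun A S hS hA V hV => V.sub_mem A S hS (hA V hV)
      prod_mem := fun ι A hA V hV => V.prod_mem ι A (fun i => hA i V hV) }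

instance (L : FirstOrder.Language.{u, v}) : CompleteLattice (Variety L) :=
  completeLatticeOfInf (Variety L) fun _ =>
    ⟨fun _ hV _ hA => hA _ hV, fun _ hW _ hA _ hV => hW hV hA⟩

/-- The variety `V(A)` generated by an algebra `A`. -/
def Variety.generatedBy {L : FirstOrder.Language.{u, v}} (A : Alg L) : Variety L :=
  sInf {V | A ∈ V}

/-- The lattice of subvarieties of `V`. -/
abbrev SubvarietyLattice {L : FirstOrder.Language.{u, v}} (V : Variety L) : Type (max (u + 1) v) :=
  Set.Iic V

/-- An identity `s ≈ t` of type `L`, over the variables `x₀, x₁, x₂, …`. -/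
abbrev Identity (L : FirstOrder.Language.{u, v}) : Type u := L.Term ℕ × L.Term ℕ

/-- The algebra `A` satisfies the identity `e`. -/
def Alg.Satisfies {L : FirstOrder.Language.{u, v}} (A : Alg L) (e : Identity L) : Prop :=
  ∀ x : ℕ → A, e.1.realize x = e.2.realize x

/-- The identity `e` holds in (every member of) the variety `V`. -/
def Variety.Satisfies {L : FirstOrder.Language.{u, v}} (V : Variety L) (e : Identity L) : Prop :=
  ∀ A ∈ V, Alg.Satisfies A e

/-- An identity is regular when the same variables occur on its two sides. -/
def Identity.IsRegular {L : FirstOrder.Language.{u, v}} (e : Identity L) : Prop :=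
  e.1.varFinset = e.2.varFinset

theorem Alg.Satisfies.image {L : FirstOrder.Language.{u, v}} {A B : Alg L} {e : Identity L}
    (hA : A.Satisfies e) (f : A →[L] B) (hf : Function.Surjective f) : B.Satisfies e := by
  intro y
  obtain ⟨g, hg⟩ := hf.hasRightInverse
  have hy : y = f ∘ (g ∘ y) := by
    funext n
    exact (hg (y n)).symm
  rw [hy, FirstOrder.Language.HomClass.realize_term, FirstOrder.Language.HomClass.realize_term, hA]

theorem Alg.Satisfies.sub {L : FirstOrder.Language.{u, v}} {A : Alg L} {e : Identity L}
    (hA : A.Satisfies e) (S : L.Substructure A) (hS : Nonempty S) :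
    (A.sub S hS).Satisfies e := by
  intro (y : ℕ → S)
  apply S.subtype_injective
  change S.subtype (e.1.realize y) = S.subtype (e.2.realize y)
  rw [← FirstOrder.Language.HomClass.realize_term, ← FirstOrder.Language.HomClass.realize_term, hA]

/-- The projection homomorphisms of a product. -/
def Alg.proj {L : FirstOrder.Language.{u, v}} {ι : Type u} (A : ι → Alg L) (i : ι) :
    Alg.prod A →[L] A i where
  toFun := fun x => x i
  map_fun' := fun _ _ => rfl
  map_rel' := fun _ _ h => h i

theorem Alg.Satisfies.prod {L : FirstOrder.Language.{u, v}} {ι : Type u} {A : ι → Alg L}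
    {e : Identity L} (hA : ∀ i, (A i).Satisfies e) : (Alg.prod A).Satisfies e := by
  intro x
  funext i
  change Alg.proj A i _ = Alg.proj A i _
  rw [← FirstOrder.Language.HomClass.realize_term, ← FirstOrder.Language.HomClass.realize_term, hA]

/-- The variety axiomatized by a set `E` of identities. -/
def Variety.ofIdentities {L : FirstOrder.Language.{u, v}} (E : Set (Identity L)) : Variety L where
  carrier := {A | ∀ e ∈ E, A.Satisfies e}
  hom_mem := fun _ _ f hf hA e he => (hA e he).image f hf
  sub_mem := fun _ S hS hA e he => (hA e he).sub S hS
  prod_mem := fun _ _ hA e he => Alg.Satisfies.prod (fun i => hA i e he)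

/-- The regularization `R(V)`: the variety axiomatized by the regular identities of `V`. -/
def Variety.regularization {L : FirstOrder.Language.{u, v}} (V : Variety L) : Variety L :=
  Variety.ofIdentities {e | e.IsRegular ∧ V.Satisfies e}

/-- `V` is strongly irregular: `V ⊨ f(x,y) ≈ x` for some binary term `f(x,y)` in which both `x`
and `y` actually occur. (Such a term exists only if some operation symbol has arity at least `2`,
so that `L` is then a plural type.) -/
def Variety.IsStronglyIrregular {L : FirstOrder.Language.{u, v}} (V : Variety L) : Prop :=
  ∃ f : L.Term (Fin 2), f.varFinset = {0, 1} ∧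
    ∀ A ∈ V, ∀ x : Fin 2 → A, f.realize x = x 0

/-- The trivial variety, which satisfies every identity. -/
def Variety.trivial (L : FirstOrder.Language.{u, v}) : Variety L :=
  Variety.ofIdentities Set.univ

/-- The variety `SL` of (algebras of type `L` term equivalent to) semilattices: the regularization
of the trivial variety. -/
def Variety.SL (L : FirstOrder.Language.{u, v}) : Variety L :=
  (Variety.trivial L).regularization

/-- The two-element semilattice `0 < 1` as an algebra of type `L`: every operation symbol is
interpreted as the join of its arguments, and in particular every constant as `0`. -/
noncomputable def twoSemilattice (L : FirstOrder.Language.{u, v}) : Alg L where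
  carrier := ULift.{u} Bool
  str :=
    { funMap := fun _ x => ⟨Finset.univ.sup fun i => (x i).down⟩
      RelMap := fun _ _ => False }

/-- `(a, b)` is a splitting pair of a lattice: `a ≰ b`, and every `c` has `a ≤ c` or `c ≤ b`. -/
def IsSplittingPair {P : Type*} [Lattice P] (a b : P) : Prop :=
  ¬ a ≤ b ∧ ∀ c : P, a ≤ c ∨ c ≤ b

/-- `V₁` and `V₂` are subvarieties of `V`, and `(V₁, V₂)` is a splitting pair of the lattice of
subvarieties of `V`. -/
def Variety.IsSplittingPairOf {L : FirstOrder.Language.{u, v}} (V V₁ V₂ : Variety L) : Prop :=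
  ∃ U₁ U₂ : SubvarietyLattice V, U₁.1 = V₁ ∧ U₂.1 = V₂ ∧ IsSplittingPair U₁ U₂

/-- A congruence of `A`: an equivalence relation compatible with all the operations. -/
def Alg.IsCongruence {L : FirstOrder.Language.{u, v}} (A : Alg L) (θ : Setoid A) : Prop :=
  ∀ (n : ℕ) (f : L.Functions n) (x y : Fin n → A), (∀ i, θ (x i) (y i)) →
    θ (FirstOrder.Language.Structure.funMap f x) (FirstOrder.Language.Structure.funMap f y)

/-- `A` is subdirectly irreducible: the identity congruence is not the intersection of a nonempty
family of other congruences. -/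
def Alg.IsSubdirectlyIrreducible {L : FirstOrder.Language.{u, v}} (A : Alg L) : Prop :=
  ∀ D : Set (Setoid A), D.Nonempty → (∀ θ ∈ D, A.IsCongruence θ) → sInf D = ⊥ → ⊥ ∈ D

/-- `A` is a splitting algebra in the lattice of subvarieties of `V`: a subdirectly irreducible,
finitely generated member of `V` such that `V(A)` is the first component of a splitting pair. -/
def Variety.IsSplittingAlgebra {L : FirstOrder.Language.{u, v}} (V : Variety L) (A : Alg L) : Prop :=
  A ∈ V ∧ A.IsSubdirectlyIrreducible ∧ FirstOrder.Language.Structure.FG L A ∧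
    ∃ V₂ : Variety L, V.IsSplittingPairOf (Variety.generatedBy A) V₂

end UniversalAlgebra

open UniversalAlgebra

open FirstOrder FirstOrder.Language

/-! ### Terms and the variables that occur in them. -/

namespace FirstOrder.Language.Term

variable {L : FirstOrder.Language.{u, v}}

/-! The map `C ↦ (C ⊓ V, whether SL ≤ C)` identifies the subvarieties of `R(V)` with `L(V) × {0 <
1}`: each `W ≤ V` occurs once as `W` and once as `R(W)`. A splitting pair of such a product either
comes from the factor `L(V)`, giving `(V₁, R(W))`, or from the two-element factor, giving `(SL, V)`.

Two facts carry this. A subvariety of `R(V)` with an irregular identity satisfies `f(x,y) ≈ x` and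
so lies in `V` (`SL_le_or_le`). Every `C ≤ R(V)` lies in `R(C ⊓ V)` (`le_regularization_inf`); this
is the Płonka decomposition in disguise, with `a ↦ f(a, w)` moving elements into the fibre of `w`.
Each uses that an identity of `V` becomes regular once missing variables are absorbed into the
second argument of `f`.

For algebras it remains to see that a nontrivial subdirectly irreducible member of `SL` is `2`. -/

theorem realize_congr {α M : Type*} [DecidableEq α] [L.Structure M] {t : L.Term α} {x y : α → M}
    (h : ∀ a ∈ t.varFinset, x a = y a) : t.realize x = t.realize y := by
  induction t with
  | var a => exact h a (by simp)
  | func g ts ih =>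
    simp only [realize_func]
    congr 1
    funext i
    exact ih i fun a ha => h a (Finset.mem_biUnion.2 ⟨i, Finset.mem_univ i, ha⟩)

theorem varFinset_subst {α β : Type*} [DecidableEq α] [DecidableEq β] (t : L.Term α)
    (σ : α → L.Term β) :
    (t.subst σ).varFinset = t.varFinset.biUnion fun a => (σ a).varFinset := by
  induction t with
  | var a => simp [subst]
  | func g ts ih => simp [subst, ih, Finset.biUnion_biUnion]

theorem varFinset_relabel {α β : Type*} [DecidableEq α] [DecidableEq β] (t : L.Term α)
    (e : α → β) : (t.relabel e).varFinset = t.varFinset.image e := by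
  induction t with
  | var a => simp
  | func g ts ih => simp [ih, Finset.biUnion_image]

/-- Evaluations of two terms can be computed after renaming their variables to natural numbers. -/
theorem exists_relabel_nat {α M : Type*} [Nonempty M] [L.Structure M] (s t : L.Term α)
    (x : α → M) : ∃ (e : α → ℕ) (y : ℕ → M),
      (s.relabel e).realize y = s.realize x ∧ (t.relabel e).realize y = t.realize x := by
  classical
  set F := s.varFinset ∪ t.varFinset with hF
  obtain ⟨e, he⟩ := Set.countable_iff_exists_injOn.1 F.countable_toSet
  have hy : ∃ y : ℕ → M, ∀ a ∈ F, y (e a) = x a := by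
    refine ⟨fun n => if h : ∃ a ∈ F, e a = n then x h.choose else Classical.arbitrary M,
      fun a ha => ?_⟩
    have h : ∃ b ∈ F, e b = e a := ⟨a, ha, rfl⟩
    dsimp only
    rw [dif_pos h, he (Finset.mem_coe.2 h.choose_spec.1) (Finset.mem_coe.2 ha) h.choose_spec.2]
  obtain ⟨y, hy⟩ := hy
  refine ⟨e, y, ?_, ?_⟩ <;> rw [realize_relabel] <;> refine realize_congr fun a ha => hy a ?_
  · exact Finset.mem_union_left _ ha
  · exact Finset.mem_union_right _ ha

/-- The term `f(s, t)` for a binary term `f`. -/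
def app₂ {α : Type*} (f : L.Term (Fin 2)) (s t : L.Term α) : L.Term α := f.subst ![s, t]

theorem realize_app₂ {α M : Type*} [L.Structure M] (f : L.Term (Fin 2)) (s t : L.Term α)
    (x : α → M) : (f.app₂ s t).realize x = f.realize ![s.realize x, t.realize x] := by
  rw [app₂, realize_subst]
  congr 1
  funext i
  fin_cases i <;> rfl

theorem varFinset_app₂ {α : Type*} [DecidableEq α] {f : L.Term (Fin 2)}
    (hf : f.varFinset = {0, 1}) (s t : L.Term α) :
    (f.app₂ s t).varFinset = s.varFinset ∪ t.varFinset := by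
  rw [app₂, varFinset_subst, hf]
  simp

end FirstOrder.Language.Term

namespace UniversalAlgebra

open FirstOrder.Language.Structure FirstOrder.Language.Term

variable {L : FirstOrder.Language.{u, v}}

/-! ### Birkhoff's theorem and regularizations. -/

namespace Variety

theorem le_iff {V W : Variety L} : V ≤ W ↔ ∀ A ∈ V, A ∈ W := Iff.rfl

theorem generatedBy_le_iff {A : Alg L} {V : Variety L} : generatedBy A ≤ V ↔ A ∈ V :=
  ⟨fun h => h (fun _ hW => hW), fun h => sInf_le h⟩

theorem mem_inf {V W : Variety L} {A : Alg L} : A ∈ V ⊓ W ↔ A ∈ V ∧ A ∈ W := by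
  simp only [← generatedBy_le_iff, le_inf_iff]

theorem mem_regularization {V : Variety L} {A : Alg L} :
    A ∈ V.regularization ↔ ∀ e : Identity L, e.IsRegular → V.Satisfies e → A.Satisfies e :=
  ⟨fun h e h₁ h₂ => h e ⟨h₁, h₂⟩, fun h _ he => h _ he.1 he.2⟩

/-- Birkhoff: a variety contains every algebra satisfying its identities. -/
theorem mem_of_satisfies [L.IsAlgebraic] {V : Variety L} {A : Alg L}
    (h : ∀ e : Identity L, V.Satisfies e → A.Satisfies e) : A ∈ V := by
  classical
  let P : L.Term A × L.Term A → Prop := fun p =>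
    ∃ B ∈ V, ∃ x : A → B, p.1.realize x ≠ p.2.realize x
  -- One factor for each pair of terms separated somewhere in `V` keeps the index type in `Type u`;
  -- the term values in this product form the `V`-free algebra on the set `A`.
  let ι : Type u := {p : L.Term A × L.Term A // P p}
  choose B hB x hx using fun i : ι => i.2
  have key : ∀ s t : L.Term A, (∀ i : ι, s.realize (x i) = t.realize (x i)) →
      s.realize (id : A → A) = t.realize id := by
    intro s t hst
    obtain ⟨e, y, hs, ht⟩ := Term.exists_relabel_nat s t (id : A → A)
    rw [← hs, ← ht]
    refine h (s.relabel e, t.relabel e) (fun C hC z => ?_) y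
    simp only [Term.realize_relabel]
    by_contra hne
    exact hx ⟨(s, t), C, hC, _, hne⟩ (hst _)
  let S : L.Substructure (Alg.prod B) :=
    { carrier := Set.range fun (t : L.Term A) (i : ι) => t.realize (x i)
      fun_mem := by
        intro n g y hy
        choose t ht using hy
        refine ⟨Term.func g t, funext fun i => ?_⟩
        change funMap g _ = funMap g _
        congr 1
        funext k
        exact congrFun (ht k) i }
  have hS : Nonempty S := ⟨⟨_, Term.var (Classical.arbitrary A), rfl⟩⟩
  have hSV : (Alg.prod B).sub S hS ∈ V := V.sub_mem _ _ _ (V.prod_mem _ _ hB)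
  let φ : S → A := fun y => y.2.choose.realize id
  have hφ : ∀ (y : S) (t : L.Term A), (∀ i, (y.1 : ∀ i, B i) i = t.realize (x i)) →
      φ y = t.realize id := by
    intro y t hyt
    refine key _ _ fun i => ?_
    rw [← hyt i]
    exact congrFun y.2.choose_spec i
  let Φ : ((Alg.prod B).sub S hS : Alg L) →[L] A :=
    { toFun := φ
      map_fun' := by
        intro n g y
        have hy : ∀ k, ∃ t : L.Term A, ∀ i, ((y k).1 : ∀ i, B i) i = t.realize (x i) :=
          fun k => ⟨(y k).2.choose, fun i => (congrFun (y k).2.choose_spec i).symm⟩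
        choose t ht using hy
        refine (hφ _ (Term.func g t) fun i => ?_).trans ?_
        · rw [Term.realize_func]
          change funMap g _ = funMap g _
          congr 1
          funext k
          exact ht k i
        · rw [Term.realize_func]
          congr 1
          funext k
          exact (hφ _ _ (ht k)).symm
      map_rel' := fun r => isEmptyElim r }
  refine V.hom_mem _ _ Φ (fun a => ?_) hSV
  exact ⟨⟨_, Term.var a, rfl⟩, hφ _ (Term.var a) fun i => rfl⟩

theorem satisfies_anti {V W : Variety L} (h : V ≤ W) {e : Identity L} (he : W.Satisfies e) :
    V.Satisfies e :=
  fun A hA => he A (h hA)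

theorem le_regularization (V : Variety L) : V ≤ V.regularization :=
  le_iff.2 fun A hA => mem_regularization.2 fun _ _ he => he A hA

theorem regularization_mono {V W : Variety L} (h : V ≤ W) :
    V.regularization ≤ W.regularization :=
  le_iff.2 fun _ hA => mem_regularization.2 fun e hr he =>
    mem_regularization.1 hA e hr (satisfies_anti h he)

/-- Members of the regularization satisfy the regular identities over arbitrary variables. -/
theorem realize_eq_of_mem_regularization {V : Variety L} {A : Alg L} (hA : A ∈ V.regularization)
    {α : Type*} [DecidableEq α] {s t : L.Term α} (hst : s.varFinset = t.varFinset)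
    (h : ∀ B ∈ V, ∀ y : α → B, s.realize y = t.realize y) (x : α → A) :
    s.realize x = t.realize x := by
  obtain ⟨e, y, hs, ht⟩ := Term.exists_relabel_nat s t x
  rw [← hs, ← ht]
  refine mem_regularization.1 hA (s.relabel e, t.relabel e) ?_ (fun B hB z => ?_) y
  · simp only [Identity.IsRegular, Term.varFinset_relabel, hst]
  · simpa only [Term.realize_relabel] using h B hB _

end Variety

/-! ### The two-element semilattice and the variety it generates. -/

theorem twoSemilattice_realize_down {α : Type*} [DecidableEq α] (t : L.Term α)
    (x : α → twoSemilattice L) :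
    ULift.down (t.realize x : twoSemilattice L) = t.varFinset.sup fun a => ULift.down (x a) := by
  induction t with
  | var a => simp
  | func g ts ih =>
    simp only [Term.varFinset, Finset.sup_biUnion]
    change (Finset.univ.sup fun i => ULift.down (Term.realize x (ts i) : twoSemilattice L)) = _
    exact Finset.sup_congr rfl fun i _ => ih i

theorem twoSemilattice_satisfies_iff {e : Identity L} :
    (twoSemilattice L).Satisfies e ↔ e.IsRegular := by
  constructor
  · intro h
    ext a
    -- Under the indicator valuation of `a`, a term takes the value `1` exactly when `a` occurs in
    -- it.
    let x : ℕ → twoSemilattice L := fun b => ⟨decide (b = a)⟩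
    have := (twoSemilattice_realize_down e.1 x).symm.trans
      ((congrArg ULift.down (h x)).trans (twoSemilattice_realize_down e.2 x))
    have key : ∀ F : Finset ℕ, (F.sup fun b => decide (b = a)) = decide (a ∈ F) := by
      intro F
      induction F using Finset.induction_on with
      | empty => simp
      | insert b F _ ih =>
        rw [Finset.sup_insert, ih, Bool.eq_iff_iff]
        simp [eq_comm (a := a)]
    simpa [x, key] using this
  · intro h x
    apply ULift.down_injective
    rw [twoSemilattice_realize_down, twoSemilattice_realize_down, h]

theorem twoSemilattice_mem_iff [L.IsAlgebraic] {V : Variety L} :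
    twoSemilattice L ∈ V ↔ ∀ e : Identity L, V.Satisfies e → e.IsRegular :=
  ⟨fun h _ he => twoSemilattice_satisfies_iff.1 (he _ h),
    fun h => Variety.mem_of_satisfies fun e he => twoSemilattice_satisfies_iff.2 (h e he)⟩

namespace Variety

theorem twoSemilattice_mem_regularization (V : Variety L) :
    twoSemilattice L ∈ V.regularization :=
  mem_regularization.2 fun _ hr _ => twoSemilattice_satisfies_iff.2 hr

theorem mem_trivial_iff {A : Alg L} : A ∈ Variety.trivial L ↔ Subsingleton A := by
  constructor
  · refine fun h => ⟨fun a b => ?_⟩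
    exact h (Term.var 0, Term.var 1) (Set.mem_univ _) fun n => if n = 0 then a else b
  · exact fun h e _ x => Subsingleton.elim _ _

theorem trivial_le [L.IsAlgebraic] (V : Variety L) : Variety.trivial L ≤ V :=
  le_iff.2 fun _ hA => mem_of_satisfies fun e _ => hA e (Set.mem_univ e)

theorem mem_SL_iff {A : Alg L} :
    A ∈ Variety.SL L ↔ ∀ e : Identity L, e.IsRegular → A.Satisfies e := by
  refine mem_regularization.trans (forall_congr' fun _ => forall_congr' fun _ => ?_)
  exact ⟨fun h => h fun A hA => hA _ (Set.mem_univ _), fun h _ => h⟩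

theorem SL_le_iff [L.IsAlgebraic] {V : Variety L} :
    Variety.SL L ≤ V ↔ twoSemilattice L ∈ V := by
  refine ⟨fun h => h (twoSemilattice_mem_regularization _), fun h => le_iff.2 fun A hA => ?_⟩
  exact mem_of_satisfies fun e he => mem_SL_iff.1 hA e (twoSemilattice_mem_iff.1 h e he)

theorem generatedBy_twoSemilattice [L.IsAlgebraic] :
    generatedBy (twoSemilattice L) = Variety.SL L :=
  le_antisymm (generatedBy_le_iff.2 (twoSemilattice_mem_regularization _))
    (SL_le_iff.2 (generatedBy_le_iff.1 le_rfl))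

end Variety

/-- The quotient of an algebra by a congruence. -/
noncomputable def Alg.quotient [L.IsAlgebraic] (A : Alg L) (θ : Setoid A) : Alg L where
  carrier := Quotient θ
  str :=
    { funMap := fun g y => Quotient.mk θ (funMap g fun i => (y i).out)
      RelMap := fun r => isEmptyElim r }
  ne := ⟨Quotient.mk θ (Classical.arbitrary A)⟩

theorem Alg.exists_quotient [L.IsAlgebraic] (A : Alg L) (θ : Setoid A) (hθ : A.IsCongruence θ) :
    ∃ (B : Alg L) (k : A →[L] B), Function.Surjective k ∧ ∀ a b, k a = k b ↔ θ a b := by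
  let k : A →[L] A.quotient θ :=
    { toFun := Quotient.mk θ
      map_fun' := fun g x =>
        Quotient.sound (hθ _ g _ _ fun i => θ.symm (Quotient.mk_out (x i)))
      map_rel' := fun r => isEmptyElim r }
  exact ⟨A.quotient θ, k, Quotient.mk_surjective, fun a b => Quotient.eq⟩

theorem Alg.isSubdirectlyIrreducible_of_two {A : Alg L} {c d : A} (hcd : c ≠ d)
    (h : ∀ z, z = c ∨ z = d) : A.IsSubdirectlyIrreducible := by
  intro D _ _ hD
  by_contra hbot
  refine hcd ?_
  have : (⊥ : Setoid A) c d := by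
    rw [← hD]
    intro θ hθ
    by_contra hn
    refine hbot ?_
    convert hθ
    refine (eq_bot_iff.2 fun x y hxy => ?_).symm
    change x = y
    rcases h x with rfl | rfl <;> rcases h y with rfl | rfl
    · rfl
    · exact absurd hxy hn
    · exact absurd (θ.symm hxy) hn
    · rfl
  exact this

/-! ### Subvarieties of the regularization and their splitting pairs. -/

namespace Variety

theorem isSplittingPairOf_iff {V V₁ V₂ : Variety L} :
    V.IsSplittingPairOf V₁ V₂ ↔
      V₁ ≤ V ∧ V₂ ≤ V ∧ ¬ V₁ ≤ V₂ ∧ ∀ C ≤ V, V₁ ≤ C ∨ C ≤ V₂ := by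
  constructor
  · rintro ⟨⟨_, h₁⟩, ⟨_, h₂⟩, rfl, rfl, hn, h⟩
    exact ⟨h₁, h₂, hn, fun C hC => h ⟨C, hC⟩⟩
  · rintro ⟨h₁, h₂, hn, h⟩
    exact ⟨⟨V₁, h₁⟩, ⟨V₂, h₂⟩, rfl, rfl, hn, fun C => h C.1 C.2⟩

variable {f : L.Term (Fin 2)}

/-- An identity `s ≈ t` of `V` yields the regular identity `f(s,t) ≈ f(t,s)`, from which `f(x,y) ≈
x` recovers `s ≈ t`. -/
theorem mem_of_mem_regularization [L.IsAlgebraic] {V : Variety L} (hf : f.varFinset = {0, 1})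
    (hfV : ∀ A ∈ V, ∀ a b : A, f.realize ![a, b] = a) {A : Alg L} (hA : A ∈ V.regularization)
    (h : ∀ a b : A, f.realize ![a, b] = a) : A ∈ V := by
  refine mem_of_satisfies fun e he x => ?_
  have key := realize_eq_of_mem_regularization hA
    (s := f.app₂ e.1 e.2) (t := f.app₂ e.2 e.1)
    (by rw [varFinset_app₂ hf, varFinset_app₂ hf, Finset.union_comm])
    (fun B hB y => by rw [realize_app₂, realize_app₂, hfV B hB, hfV B hB, he B hB]) x
  rwa [realize_app₂, realize_app₂, h, h] at key

theorem regularization_inf_le [L.IsAlgebraic] {V W : Variety L} (hf : f.varFinset = {0, 1})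
    (hfV : ∀ A ∈ V, ∀ a b : A, f.realize ![a, b] = a) (hW : W ≤ V) :
    W.regularization ⊓ V ≤ W :=
  le_iff.2 fun A hA => mem_of_mem_regularization hf (fun B hB => hfV B (hW hB))
    (mem_inf.1 hA).1 (hfV A (mem_inf.1 hA).2)

theorem le_of_irregular [L.IsAlgebraic] {V C : Variety L} (hf : f.varFinset = {0, 1})
    (hfV : ∀ A ∈ V, ∀ a b : A, f.realize ![a, b] = a) (hC : C ≤ V.regularization)
    {s t : L.Term ℕ} (hst : C.Satisfies (s, t)) {i : ℕ} (hs : i ∈ s.varFinset)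
    (ht : i ∉ t.varFinset) : C ≤ V := by
  refine le_iff.2 fun A hA => mem_of_mem_regularization hf hfV (hC hA) fun a b => ?_
  -- With `y` for variable `i` and `x` for all others, `y` occurs in `s` but not in `t`. So `f(x,y)
  -- ≈ f(x,s) ≈ f(x,t) ≈ x`, the outer two identities being regular identities of `V`.
  let σ : ℕ → L.Term (Fin 2) := fun j => if j = i then var 1 else var 0
  have hσ : (s.subst σ).realize ![a, b] = (t.subst σ).realize ![a, b] := by
    rw [realize_subst, realize_subst]
    exact hst A hA _
  have h1 := realize_eq_of_mem_regularization (hC hA)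
    (s := f.app₂ (var 0) (var 1)) (t := f.app₂ (var 0) (s.subst σ))
    (by
      rw [varFinset_app₂ hf, varFinset_app₂ hf, varFinset_subst]
      ext k
      fin_cases k
      · simp
      · simp only [varFinset, Finset.mem_union, Finset.mem_biUnion]
        exact iff_of_true (by simp) (Or.inr ⟨i, hs, by simp [σ]⟩))
    (fun B hB y => by rw [realize_app₂, realize_app₂, hfV B hB, hfV B hB]) ![a, b]
  have h2 := realize_eq_of_mem_regularization (hC hA)
    (s := f.app₂ (var 0) (t.subst σ)) (t := var 0)
    (by
      rw [varFinset_app₂ hf, varFinset_subst, varFinset]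
      refine Finset.union_eq_left.2 (Finset.biUnion_subset.2 fun j hj => ?_)
      have hji : j ≠ i := fun h => ht (h ▸ hj)
      simp [σ, hji])
    (fun B hB y => by rw [realize_app₂, hfV B hB]) ![a, b]
  rw [realize_app₂, realize_app₂, hσ, ← realize_app₂ f (var 0) (t.subst σ), h2] at h1
  exact h1

theorem SL_le_or_le [L.IsAlgebraic] {V C : Variety L} (hf : f.varFinset = {0, 1})
    (hfV : ∀ A ∈ V, ∀ a b : A, f.realize ![a, b] = a) (hC : C ≤ V.regularization) :
    Variety.SL L ≤ C ∨ C ≤ V := by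
  rw [SL_le_iff, twoSemilattice_mem_iff, or_iff_not_imp_left]
  intro h
  push Not at h
  obtain ⟨⟨s, t⟩, he, hr⟩ := h
  by_cases hst : s.varFinset ⊆ t.varFinset
  · have hts : ¬ t.varFinset ⊆ s.varFinset := fun h => hr (Finset.Subset.antisymm hst h)
    obtain ⟨i, hi, hi'⟩ := Finset.not_subset.1 hts
    exact le_of_irregular hf hfV hC (fun A hA x => (he A hA x).symm) hi hi'
  · obtain ⟨i, hi, hi'⟩ := Finset.not_subset.1 hst
    exact le_of_irregular hf hfV hC he hi hi'

theorem not_SL_le [L.IsAlgebraic] {V : Variety L} (hf : f.varFinset = {0, 1})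
    (hfV : ∀ A ∈ V, ∀ a b : A, f.realize ![a, b] = a) : ¬ Variety.SL L ≤ V := by
  rw [SL_le_iff]
  intro h
  have := congrArg ULift.down (hfV _ h ⟨false⟩ ⟨true⟩)
  rw [twoSemilattice_realize_down, hf] at this
  simp at this

/-- Both sides reduce to `g(x)` in `V` and have the same variables. Hence the kernel of `x ↦ f(x,a)`
is a congruence. -/
theorem realize_funMap_retract {V : Variety L} (hf : f.varFinset = {0, 1})
    (hfV : ∀ A ∈ V, ∀ a b : A, f.realize ![a, b] = a) {A : Alg L} (hA : A ∈ V.regularization)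
    {n : ℕ} (g : L.Functions n) (x : Fin n → A) (a : A) :
    f.realize ![funMap g x, a] = f.realize ![funMap g fun i => f.realize ![x i, a], a] := by
  have := realize_eq_of_mem_regularization hA
    (s := f.app₂ (func g fun i => var (some i)) (var none))
    (t := f.app₂ (func g fun i => f.app₂ (var (some i)) (var none)) (var none))
    (by
      simp only [varFinset_app₂ hf, varFinset]
      ext j
      cases j <;> simp)
    (fun B hB y => by
      simp only [realize_app₂, hfV B hB, realize_func])
    (fun j : Option (Fin n) => j.elim a x)
  simpa only [realize_app₂, realize_func, realize_var, Option.elim] using this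

theorem le_regularization_inf [L.IsAlgebraic] {V C : Variety L} (hf : f.varFinset = {0, 1})
    (hfV : ∀ A ∈ V, ∀ a b : A, f.realize ![a, b] = a) (hC : C ≤ V.regularization) :
    C ≤ (C ⊓ V).regularization := by
  refine le_iff.2 fun A hA => mem_regularization.2 fun e hr he x => ?_
  have hAR := hC hA
  -- Only variables of the identity are allowed, so that `w` below lies in the top Płonka fibre of
  -- this subalgebra.
  let S : L.Substructure A :=
    { carrier := {a | ∃ r : L.Term ℕ, r.varFinset ⊆ e.1.varFinset ∧ r.realize x = a}
      fun_mem := by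
        intro n g y hy
        choose r hr hry using hy
        refine ⟨func g r, ?_, ?_⟩
        · simpa using hr
        · rw [realize_func]
          congr 1
          funext i
          exact hry i }
  have hS : Nonempty S := ⟨⟨_, e.1, subset_rfl, rfl⟩⟩
  let A' : Alg L := A.sub S hS
  let ι : A' →[L] A := S.subtype.toHom
  have hι : ∀ a : A', ∃ r : L.Term ℕ, r.varFinset ⊆ e.1.varFinset ∧ r.realize x = ι a :=
    fun a => a.2
  have hA'C : A' ∈ C := C.sub_mem _ _ _ hA
  let w : A := e.1.realize x
  let θ : Setoid A' := Setoid.ker fun a => f.realize ![ι a, w]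
  have hθ : A'.IsCongruence θ := by
    intro n g y z hyz
    change f.realize ![ι (funMap g y), w] = f.realize ![ι (funMap g z), w]
    rw [Hom.map_fun, Hom.map_fun, realize_funMap_retract hf hfV hAR,
      realize_funMap_retract hf hfV hAR g (ι ∘ z)]
    have : (fun i => f.realize ![(ι ∘ y) i, w]) = fun i => f.realize ![(ι ∘ z) i, w] :=
      funext hyz
    rw [this]
  obtain ⟨B, k, hk, hkθ⟩ := A'.exists_quotient θ hθ
  have hBC : B ∈ C := C.hom_mem _ _ k hk hA'C
  have hBV : B ∈ V := by
    refine mem_of_mem_regularization hf hfV (hC hBC) fun b₁ b₂ => ?_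
    obtain ⟨a₁, rfl⟩ := hk b₁
    obtain ⟨a₂, rfl⟩ := hk b₂
    obtain ⟨r₁, hr₁, hx₁⟩ := hι a₁
    obtain ⟨r₂, hr₂, hx₂⟩ := hι a₂
    have h1 : ![k a₁, k a₂] = k ∘ ![a₁, a₂] := by
      funext i
      fin_cases i <;> rfl
    have h2 : ι ∘ ![a₁, a₂] = ![r₁.realize x, r₂.realize x] := by
      funext i
      fin_cases i
      · exact hx₁.symm
      · exact hx₂.symm
    rw [h1, HomClass.realize_term, hkθ]
    change f.realize ![ι _, w] = f.realize ![ι a₁, w]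
    rw [← HomClass.realize_term, h2, ← hx₁, ← realize_app₂, ← realize_app₂, ← realize_app₂]
    -- The identity `f(f(r₁,r₂),s) ≈ f(r₁,s)`, regular because the variables of `r₂` occur in `s`.
    refine realize_eq_of_mem_regularization hAR ?_ (fun D hD y => ?_) x
    · simp only [varFinset_app₂ hf]
      rw [Finset.union_assoc, Finset.union_eq_right.2 hr₂]
    · simp only [realize_app₂, hfV D hD]
  classical
  let y : ℕ → A' := fun n =>
    if h : n ∈ e.1.varFinset then ⟨x n, var n, by simpa using h, rfl⟩ else Classical.arbitrary A'
  have hy : ∀ t : L.Term ℕ, t.varFinset = e.1.varFinset → ι (t.realize y) = t.realize x := by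
    intro t ht
    rw [← HomClass.realize_term]
    refine realize_congr fun n hn => ?_
    rw [ht] at hn
    have hyn : y n = ⟨x n, var n, by simpa using hn, rfl⟩ := dif_pos hn
    rw [Function.comp_apply, hyn]
    rfl
  have hB := he B (mem_inf.2 ⟨hBC, hBV⟩) (k ∘ y)
  rw [HomClass.realize_term, HomClass.realize_term, hkθ] at hB
  replace hB : f.realize ![ι (e.1.realize y), w] = f.realize ![ι (e.2.realize y), w] := hB
  rw [hy _ rfl, hy _ hr.symm, ← realize_app₂, ← realize_app₂] at hB
  -- For `e = (s,t)` the chain is `s = f(s,s) = f(t,s) = t`; the quotient supplies the middle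
  -- equality, regularity the other two.
  rw [← realize_eq_of_mem_regularization hAR (s := f.app₂ e.1 e.1) (t := e.1)
    (by rw [varFinset_app₂ hf, Finset.union_self])
    (fun D hD z => by rw [realize_app₂, hfV D hD]), hB]
  exact realize_eq_of_mem_regularization hAR (s := f.app₂ e.2 e.1) (t := e.2)
    (by rw [varFinset_app₂ hf, hr, Finset.union_self])
    (fun D hD z => by rw [realize_app₂, hfV D hD]) x

theorem isSplittingPairOf_regularization_iff [L.IsAlgebraic] {V : Variety L}
    (hf : f.varFinset = {0, 1}) (hfV : ∀ A ∈ V, ∀ a b : A, f.realize ![a, b] = a)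
    (V₁ V₂ : Variety L) :
    V.regularization.IsSplittingPairOf V₁ V₂ ↔
      (V₁ = Variety.SL L ∧ V₂ = V) ∨
        ∃ W : Variety L, W ≤ V ∧ V₂ = W.regularization ∧ V.IsSplittingPairOf V₁ W := by
  have hSLR : ∀ W : Variety L, Variety.SL L ≤ W.regularization := fun W =>
    SL_le_iff.2 (twoSemilattice_mem_regularization W)
  have hSLV := not_SL_le hf hfV
  have hle := V.le_regularization
  have hinf : ∀ W ≤ V, ∀ C ≤ V, C ≤ W.regularization → C ≤ W := fun W hW C hC hCW =>
    (le_inf hCW hC).trans (regularization_inf_le hf hfV hW)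
  have hback : ∀ C : Variety L, Variety.SL L ≤ C → (C ⊓ V).regularization ≤ C := by
    intro C hC
    refine le_iff.2 fun A hA => mem_of_satisfies fun e he => ?_
    exact mem_regularization.1 hA e (twoSemilattice_mem_iff.1 (SL_le_iff.1 hC) e he)
      (satisfies_anti inf_le_left he)
  simp only [isSplittingPairOf_iff]
  constructor
  · rintro ⟨h₁, h₂, hn, h⟩
    rcases SL_le_or_le hf hfV h₂ with hS | h₂V
    · right
      have hV₂ : V₂ = (V₂ ⊓ V).regularization :=
        le_antisymm (le_regularization_inf hf hfV h₂) (hback _ hS)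
      -- Otherwise `V ≤ V₂`, and then `V₂ = R(V)` contains `V₁`.
      have h₁V : V₁ ≤ V := by
        refine (h V hle).resolve_right fun hV => hn (h₁.trans ?_)
        rw [hV₂, inf_eq_right.2 hV]
      refine ⟨V₂ ⊓ V, inf_le_right, hV₂, h₁V, inf_le_right,
        fun h' => hn (h'.trans inf_le_left), fun C hC => ?_⟩
      exact (h C (hC.trans hle)).imp_right fun h' => le_inf h' hC
    · left
      have h₁S : V₁ ≤ Variety.SL L :=
        (h _ (hSLR V)).resolve_right fun h' => hSLV (h'.trans h₂V)
      -- Otherwise `V₁` lies in both `V` and `SL`, hence is trivial and below `V₂`.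
      have hS₁ : Variety.SL L ≤ V₁ := by
        refine (SL_le_or_le hf hfV h₁).resolve_right fun h₁V => hn ?_
        exact (hinf _ (trivial_le V) _ h₁V h₁S).trans (trivial_le V₂)
      refine ⟨le_antisymm h₁S hS₁, le_antisymm h₂V ?_⟩
      exact (h V hle).resolve_left fun h' => hSLV (hS₁.trans h')
  · rintro (⟨rfl, rfl⟩ | ⟨W, hW, rfl, h₁, -, hn, h⟩)
    · exact ⟨hSLR _, hle, hSLV, fun C hC => SL_le_or_le hf hfV hC⟩
    · refine ⟨h₁.trans hle, regularization_mono hW, fun h' => hn (hinf W hW _ h₁ h'),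
        fun C hC => ?_⟩
      refine (h (C ⊓ V) inf_le_right).imp (fun h' => h'.trans inf_le_left) fun h' => ?_
      exact (le_regularization_inf hf hfV hC).trans (regularization_mono h')

/-! ### Subdirectly irreducible semilattices and splitting algebras. -/

theorem realize_eq_of_mem_SL {A : Alg L} (hA : A ∈ Variety.SL L) {α : Type*} [DecidableEq α]
    {s t : L.Term α} (hst : s.varFinset = t.varFinset) (x : α → A) :
    s.realize x = t.realize x :=
  realize_eq_of_mem_regularization hA hst
    (fun _ hB _ => (mem_trivial_iff.1 hB).elim _ _) x

/-- The principal ideals of a semilattice are compatible with all operations. -/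
theorem funMap_le_iff {A : Alg L} (hA : A ∈ Variety.SL L) (hf : f.varFinset = {0, 1})
    {n : ℕ} (g : L.Functions n) (x : Fin n → A) (a : A) :
    f.realize ![funMap g x, a] = a ↔ ∀ i, f.realize ![x i, a] = a := by
  constructor
  · intro h i
    have := realize_eq_of_mem_SL hA
      (s := f.app₂ (var (some i)) (f.app₂ (func g fun i => var (some i)) (var none)))
      (t := f.app₂ (func g fun i => var (some i)) (var none))
      (by
        simp only [varFinset_app₂ hf, varFinset]
        ext j
        cases j <;> simp)
      (fun j : Option (Fin n) => j.elim a x)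
    simp only [realize_app₂, realize_func, realize_var, Option.elim] at this
    rwa [h] at this
  · intro h
    rw [realize_funMap_retract hf (V := Variety.trivial L)
      (fun B hB _ _ => (mem_trivial_iff.1 hB).elim _ _) hA]
    simp only [h]
    have := realize_eq_of_mem_SL hA (s := f.app₂ (func g fun _ => var 0) (var 0)) (t := var 0)
      (by
        simp only [varFinset_app₂ hf, varFinset]
        ext j
        simp) (fun _ : Fin 1 => a)
    simpa only [realize_app₂, realize_func, realize_var] using this

theorem nonempty_equiv_twoSemilattice [L.IsAlgebraic] {A : Alg L} (hA : A ∈ Variety.SL L)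
    (hf : f.varFinset = {0, 1}) (hSI : A.IsSubdirectlyIrreducible) (hne : ¬ Subsingleton A) :
    Nonempty (A ≃[L] twoSemilattice L) := by
  have idem : ∀ a : A, f.realize ![a, a] = a := by
    intro a
    have := realize_eq_of_mem_SL hA (s := f.app₂ (var 0) (var 0)) (t := var 0)
      (by simp only [varFinset_app₂ hf, Finset.union_self]) (fun _ : Fin 1 => a)
    simpa only [realize_app₂, realize_var] using this
  have comm : ∀ a b : A, f.realize ![a, b] = f.realize ![b, a] := by
    intro a b
    have := realize_eq_of_mem_SL hA (s := f.app₂ (var 0) (var 1)) (t := f.app₂ (var 1) (var 0))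
      (by simp only [varFinset_app₂ hf, Finset.union_comm]) ![a, b]
    simp only [realize_app₂, realize_var] at this
    exact this
  -- Here `f` is a join, and `θ a` has at most two classes: the ideal below `a` and its complement.
  -- By antisymmetry these congruences meet in equality, so subdirect irreducibility makes one of
  -- them equality.
  let θ : A → Setoid A := fun a => Setoid.ker fun x => f.realize ![x, a] = a
  obtain ⟨a, ha⟩ : ⊥ ∈ Set.range θ := by
    refine hSI _ (Set.range_nonempty θ) ?_ (eq_bot_iff.2 fun x y hxy => ?_)
    · rintro _ ⟨a, rfl⟩ n g x y hxy
      refine propext ?_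
      change f.realize ![funMap g x, a] = a ↔ f.realize ![funMap g y, a] = a
      rw [funMap_le_iff hA hf, funMap_le_iff hA hf]
      exact forall_congr' fun i => iff_of_eq (hxy i)
    · have h : ∀ a, (f.realize ![x, a] = a) = (f.realize ![y, a] = a) :=
        fun a => hxy (θ a) ⟨a, rfl⟩
      have h₁ : f.realize ![y, x] = x := h x ▸ idem x
      have h₂ : f.realize ![x, y] = y := (h y).symm ▸ idem y
      change x = y
      rw [← h₁, comm, h₂]
  have hinj : ∀ x y : A, ((f.realize ![x, a] = a) ↔ (f.realize ![y, a] = a)) → x = y := by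
    intro x y hxy
    have : θ a x y := propext hxy
    rw [ha] at this
    exact this
  classical
  let φ : A → twoSemilattice L := fun x => ⟨decide (f.realize ![x, a] ≠ a)⟩
  have hφi : Function.Injective φ := by
    intro x y hxy
    have := congrArg ULift.down hxy
    simp only [φ, decide_eq_decide] at this
    exact hinj x y (not_iff_not.1 this)
  have hφs : Function.Surjective φ := by
    rintro ⟨b⟩
    cases b
    · exact ⟨a, by simp only [φ, idem, ne_eq, not_true, decide_false]; rfl⟩
    · by_contra hb
      refine hne ⟨fun x y => hφi ?_⟩
      have : ∀ z, φ z = ⟨false⟩ := by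
        intro z
        by_contra hz
        refine hb ⟨z, ?_⟩
        apply ULift.down_injective
        cases h : (φ z).down
        · exact absurd (ULift.down_injective h) hz
        · rfl
      rw [this, this]
  refine ⟨{ Equiv.ofBijective φ ⟨hφi, hφs⟩ with
    map_fun' := fun g x => ?_
    map_rel' := fun r => isEmptyElim r }⟩
  change φ (funMap g x) = (⟨Finset.univ.sup fun i => (φ (x i)).down⟩ : ULift Bool)
  apply ULift.down_injective
  rw [Bool.eq_iff_iff]
  simp only [φ, ne_eq, funMap_le_iff hA hf]
  rw [decide_eq_true_iff, ← not_iff_not, not_not, Bool.not_eq_true]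
  refine Iff.trans ?_ (Finset.sup_eq_bot_iff _ _).symm
  simp only [Finset.mem_univ, true_imp_iff]
  exact forall_congr' fun i => by rw [show (⊥ : Bool) = false from rfl, decide_eq_false_iff_not, not_not]

theorem mem_of_equiv [L.IsAlgebraic] {A B : Alg L} (φ : A ≃[L] B) {V : Variety L} (hA : A ∈ V) :
    B ∈ V :=
  V.hom_mem A B φ.toHom φ.surjective hA

theorem isSplittingAlgebra_regularization_iff [L.IsAlgebraic] {V : Variety L}
    (hf : f.varFinset = {0, 1}) (hfV : ∀ A ∈ V, ∀ a b : A, f.realize ![a, b] = a) (A : Alg L) :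
    V.regularization.IsSplittingAlgebra A ↔
      V.IsSplittingAlgebra A ∨ Nonempty (A ≃[L] twoSemilattice L) := by
  have hpair := isSplittingPairOf_regularization_iff hf hfV
  constructor
  · rintro ⟨-, hSI, hFG, V₂, h⟩
    rcases (hpair _ _).1 h with ⟨hA, rfl⟩ | ⟨W, -, -, hW⟩
    -- One-element algebras count as subdirectly irreducible here; they are excluded because `SL` is
    -- not trivial.
    · refine Or.inr (nonempty_equiv_twoSemilattice (generatedBy_le_iff.1 hA.le) hf hSI fun hs => ?_)
      have : Variety.SL L ≤ Variety.trivial L :=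
        hA ▸ generatedBy_le_iff.2 (mem_trivial_iff.2 hs)
      have := (mem_trivial_iff.1 (SL_le_iff.1 this)).elim ⟨false⟩ ⟨true⟩
      exact Bool.false_ne_true (congrArg ULift.down this)
    · exact Or.inl ⟨generatedBy_le_iff.1 (isSplittingPairOf_iff.1 hW).1, hSI, hFG, W, hW⟩
  · rintro (⟨hA, hSI, hFG, W, hW⟩ | ⟨⟨φ⟩⟩)
    · exact ⟨V.le_regularization hA, hSI, hFG, W.regularization,
        (hpair _ _).2 (Or.inr ⟨W, (isSplittingPairOf_iff.1 hW).2.1, rfl, hW⟩)⟩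
    · have hgen : generatedBy A = Variety.SL L := by
        rw [← generatedBy_twoSemilattice]
        exact le_antisymm
          (generatedBy_le_iff.2 (mem_of_equiv φ.symm (generatedBy_le_iff.1 le_rfl)))
          (generatedBy_le_iff.2 (mem_of_equiv φ (generatedBy_le_iff.1 le_rfl)))
      have hfin : Finite A := Finite.of_equiv (ULift Bool) φ.symm.toEquiv
      refine ⟨mem_of_equiv φ.symm (twoSemilattice_mem_regularization V), ?_,
        Structure.FG.of_finite, V, (hpair _ _).2 (Or.inl ⟨hgen, rfl⟩)⟩
      refine Alg.isSubdirectlyIrreducible_of_two (c := φ.symm ⟨false⟩) (d := φ.symm ⟨true⟩)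
        (fun h => ?_) fun z => ?_
      · exact Bool.false_ne_true (congrArg ULift.down (φ.symm.injective h))
      · have hz : φ.symm (φ z) = z := φ.symm_apply_apply z
        rw [← hz]
        rcases φ z with ⟨_ | _⟩
        · exact Or.inl rfl
        · exact Or.inr rfl

end Variety

end UniversalAlgebra

theorem mainTheorem5 {L : FirstOrder.Language.{u, v}} [L.IsAlgebraic] (V : Variety L)
    (hV : V.IsStronglyIrregular) :
    (∀ V₁ V₂ : Variety L,
      V.regularization.IsSplittingPairOf V₁ V₂ ↔
        (V₁ = Variety.SL L ∧ V₂ = V) ∨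
          ∃ W : Variety L, W ≤ V ∧ V₂ = W.regularization ∧ V.IsSplittingPairOf V₁ W) ∧
    (∀ A : Alg L,
      V.regularization.IsSplittingAlgebra A ↔
        V.IsSplittingAlgebra A ∨ Nonempty (A ≃[L] twoSemilattice L)) ∧
    (∀ A : Alg L, A ∈ V → (V.regularization.IsSplittingAlgebra A ↔ V.IsSplittingAlgebra A)) := by
  obtain ⟨f, hf, hfV'⟩ := hV
  have hfV : ∀ A ∈ V, ∀ a b : A, f.realize ![a, b] = a := fun A hA a b => hfV' A hA ![a, b]
  refine ⟨Variety.isSplittingPairOf_regularization_iff hf hfV,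
    Variety.isSplittingAlgebra_regularization_iff hf hfV, fun A hA => ?_⟩
  rw [Variety.isSplittingAlgebra_regularization_iff hf hfV]
  refine or_iff_left ?_
  rintro ⟨φ⟩
  exact Variety.not_SL_le hf hfV (Variety.SL_le_iff.2 (Variety.mem_of_equiv φ hA))
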